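/- Let $\Phi:[0,\infty)\to\mathbb R$ be a continuous, non-decreasing, concave function such that $\Phi(x)/x\to0$ as $x\to\infty$ and $\Phi(0)<\log 2$. Assume that on a neighbourhood of $+\infty$ the function $\Phi$ is $\mathcal C^2$ and, for some $\theta>1$, $\Phi^\theta$ is convex there. Assume that $Z_\Phi=\int_{\mathbb R}e^{-\Phi(|x|)}\,dx<\infty$, let $\mu$ be the probability measure $d\mu(x)=Z_\Phi^{-1}e^{-\Phi(|x|)}\,dx$ on $\mathbb R$, and let $\mu^n$ be its $n$-fold product on $\mathbb R^n$. (Then $\Phi$ is a strictly increasing bijection onto $[\Phi(0),\infty)$; $\Phi^{-1}$ denotes its inverse and $\Phi'$ its right derivative.) For a Borel probability measure $\nu$ on $\mathbb R^n$ with the Euclidean distance $d$ and a Borel set $A\subset\mathbb R^n$, put $\nu_s(\partial A)=\liminf_{h\to0^+}\nu(A_h\setminus A)/h$, where $A_h=\{x: d(x,A)\le h\}$ and $d(x,\emptyset)=+\infty$, and let $I_\nu(a)=\inf\{\nu_s(\partial A): A \text{ Borel},\ \nu(A)=a\}$ for $a\in[0,1]$ be the isoperimetric profile. Then there exists a constant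 $c>0$, depending only on $\Phi$ and not on $n$, such that for all integers $n\ge1$ and all $t\in[0,1]$, $$I_{\mu^n}(t)\ \ge\ c\,\min(t,1-t)\;\Phi'\circ\Phi^{-1}\!\left(\log\frac{n}{\min(t,1-t)}\right),$$ where the right-hand side is read as $0$ when $t\in\{0,1\}$. -/

import Mathlib

open MeasureTheory Set Filter Topology

namespace HeavyTail

/-- The measure `Z⁻¹ exp (-Φ |x|) dx` on the real line, with `Z = ∫ exp (-Φ |x|) dx`.
Only the values of `Φ` on `[0, ∞)` matter. -/
noncomputable def muPhi (Φ : ℝ → ℝ) : Measure ℝ :=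
  volume.withDensity fun x : ℝ =>
    ENNReal.ofReal ((∫ y : ℝ, Real.exp (-Φ |y|))⁻¹ * Real.exp (-Φ |x|))

/-- The `n`-fold product measure `μⁿ`, on `ℝⁿ` with its Euclidean distance. -/
noncomputable def prodMeasure (μ : Measure ℝ) (n : ℕ) : Measure (EuclideanSpace ℝ (Fin n)) :=
  (Measure.pi fun _ : Fin n => μ).map (MeasurableEquiv.toLp 2 (Fin n → ℝ))

/-- The boundary measure `μ_s(∂A) = liminf_{h → 0⁺} μ (A_h \ A) / h`, where
`A_h = {x | d(x, A) ≤ h}` is the closed `h`-enlargement of `A` (empty if `A` is empty). -/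
noncomputable def boundaryMeasure {M : Type*} [PseudoEMetricSpace M] [MeasurableSpace M]
    (μ : Measure M) (A : Set M) : ENNReal :=
  liminf (fun h : ℝ => μ (Metric.cthickening h A \ A) / ENNReal.ofReal h) (𝓝[>] (0 : ℝ))

/-- The isoperimetric profile `I_μ(a) = inf {μ_s(∂A) | A Borel, μ(A) = a}`. -/
noncomputable def isoProfile {M : Type*} [PseudoEMetricSpace M] [MeasurableSpace M]
    (μ : Measure M) (a : ℝ) : ENNReal :=
  sInf {b | ∃ A : Set M, MeasurableSet A ∧ μ A = ENNReal.ofReal a ∧ b = boundaryMeasure μ A}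

/-- The right derivative of `Φ` at `x`. -/
noncomputable def rightDeriv (Φ : ℝ → ℝ) (x : ℝ) : ℝ :=
  derivWithin Φ (Ioi x) x

/-- The inverse `Φ⁻¹` of `Φ`, as a function on `[0, ∞)`. -/
noncomputable def halfLineInv (Φ : ℝ → ℝ) : ℝ → ℝ :=
  Function.invFunOn Φ (Ici 0)

end HeavyTail

/-!
Restricted to `[-M, M]`, the measure `muPhi Φ` satisfies a Bobkov inequality by a Hardy type
argument, at a length scale given by the reciprocal of a slope of `Φ` beyond `M`; on the whole line
the inequality survives with an additive defect, the mass of the tail. The length scale is preserved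
by products and the defects add up, so `n` factors produce the defect `n · μ(|x| > M)`. At the level
`x` with `n exp (-Φ x) = min t (1 - t)`, convexity of `Φ ^ θ` near infinity yields `l` independent
of `n` with `2 Φ x ≤ Φ (l x)`. With `M = l x` the defect is then at most `min t (1 - t) / 4`, hence
absorbed by `t (1 - t)`, while concavity bounds `Φ' x` by a constant times the slope of `Φ` between
`l x` and `l² x`.
-/

namespace HeavyTail

section TestFunction

variable {E F : Type*} [NormedAddCommGroup E] [NormedSpace ℝ E]
  [NormedAddCommGroup F] [NormedSpace ℝ F] {f : E → ℝ} {L : ℝ}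

/-- The functions on which a Bobkov inequality is tested. They and their gradients are continuous
and bounded, hence integrable against every finite measure. -/
structure IsTestFunction (f : E → ℝ) : Prop where
  contDiff : ContDiff ℝ 1 f
  lipschitz : ∃ K, LipschitzWith K f
  mem_Icc : ∀ x, f x ∈ Icc (0 : ℝ) 1

/-- The integrand of Bobkov's inequality for the profile `p ↦ p (1 - p)`, at length scale `L`. -/
noncomputable def bobkovIntegrand (L : ℝ) (f : E → ℝ) (x : E) : ℝ :=
  √((f x * (1 - f x)) ^ 2 + (L * ‖fderiv ℝ f x‖) ^ 2)

/-- Bobkov's functional isoperimetric inequality for the profile `p ↦ p (1 - p)`, at length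
scale `L` and up to an additive defect `s`. -/
def DefectiveBobkov [MeasurableSpace E] (μ : Measure E) (L s : ℝ) : Prop :=
  ∀ f : E → ℝ, IsTestFunction f →
    (∫ x, f x ∂μ) * (1 - ∫ x, f x ∂μ) ≤ ∫ x, bobkovIntegrand L f x ∂μ + s

lemma mul_one_sub_mem_Icc {p : ℝ} (hp : p ∈ Icc (0 : ℝ) 1) :
    p * (1 - p) ∈ Icc (0 : ℝ) (1 / 4) :=
  ⟨mul_nonneg hp.1 (by linarith [hp.2]), by nlinarith [sq_nonneg (p - 1 / 2)]⟩

lemma sqrt_sq_add_sq_le_add {a b : ℝ} (ha : 0 ≤ a) (hb : 0 ≤ b) : √(a ^ 2 + b ^ 2) ≤ a + b :=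
  Real.sqrt_le_iff.2 ⟨by positivity, by nlinarith [mul_nonneg ha hb]⟩

lemma abs_le_sqrt_sq_add_sq (a b : ℝ) : |a| ≤ √(a ^ 2 + b ^ 2) :=
  Real.abs_le_sqrt (by linarith [sq_nonneg b])

lemma bobkovIntegrand_nonneg (x : E) : 0 ≤ bobkovIntegrand L f x :=
  Real.sqrt_nonneg _

lemma IsTestFunction.const {p : ℝ} (hp : p ∈ Icc (0 : ℝ) 1) : IsTestFunction fun _ : E => p :=
  ⟨contDiff_const, ⟨0, .const p⟩, fun _ => hp⟩

namespace IsTestFunction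

variable (hf : IsTestFunction f)
include hf

lemma continuous : Continuous f :=
  hf.contDiff.continuous

lemma differentiable : Differentiable ℝ f :=
  hf.contDiff.differentiable one_ne_zero

lemma comp {K : NNReal} {g : F → E} (hg : ContDiff ℝ 1 g) (hgK : LipschitzWith K g) :
    IsTestFunction (f ∘ g) :=
  ⟨hf.contDiff.comp hg, hf.lipschitz.imp' (· * K) fun _ hC => hC.comp hgK, fun _ => hf.mem_Icc _⟩

lemma norm_le_one (x : E) : ‖f x‖ ≤ 1 :=
  abs_le.2 ⟨by linarith [(hf.mem_Icc x).1], (hf.mem_Icc x).2⟩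

lemma norm_sub_le_one (x y : E) : ‖f x - f y‖ ≤ 1 :=
  abs_sub_le_of_le_of_le (hf.mem_Icc x).1 (hf.mem_Icc x).2 (hf.mem_Icc y).1 (hf.mem_Icc y).2
    |>.trans_eq (sub_zero 1)

lemma exists_norm_fderiv_le : ∃ K : ℝ, ∀ x, ‖fderiv ℝ f x‖ ≤ K :=
  let ⟨K, hK⟩ := hf.lipschitz
  ⟨K, fun _ => norm_fderiv_le_of_lipschitz ℝ hK⟩

lemma continuous_fderiv : Continuous (fderiv ℝ f) :=
  hf.contDiff.continuous_fderiv one_ne_zero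

lemma continuous_bobkovIntegrand : Continuous (bobkovIntegrand L f) := by
  have := hf.continuous
  have := hf.continuous_fderiv
  unfold bobkovIntegrand
  fun_prop

lemma bobkovIntegrand_le (hL : 0 ≤ L) (x : E) :
    bobkovIntegrand L f x ≤ 1 / 4 + L * ‖fderiv ℝ f x‖ := by
  have hJ := mul_one_sub_mem_Icc (hf.mem_Icc x)
  exact (sqrt_sq_add_sq_le_add hJ.1 (by positivity)).trans (by linarith [hJ.2])

variable [MeasurableSpace E] [OpensMeasurableSpace E] {μ : Measure E}

lemma integrable [IsFiniteMeasure μ] : Integrable f μ :=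
  .of_bound hf.continuous.aestronglyMeasurable 1 (.of_forall hf.norm_le_one)

lemma integral_mem_Icc [IsProbabilityMeasure μ] : ∫ x, f x ∂μ ∈ Icc (0 : ℝ) 1 := by
  refine ⟨integral_nonneg fun x => (hf.mem_Icc x).1, ?_⟩
  simpa using integral_mono (hf.integrable (μ := μ)) (integrable_const 1) fun x => (hf.mem_Icc x).2

lemma integrable_bobkovIntegrand [IsFiniteMeasure μ] : Integrable (bobkovIntegrand L f) μ := by
  obtain ⟨K, hK⟩ := hf.exists_norm_fderiv_le
  refine .of_bound hf.continuous_bobkovIntegrand.aestronglyMeasurable (1 / 4 + |L| * K)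
    (.of_forall fun x => ?_)
  rw [Real.norm_of_nonneg (bobkovIntegrand_nonneg x)]
  calc bobkovIntegrand L f x = bobkovIntegrand |L| f x := by simp [bobkovIntegrand, mul_pow]
    _ ≤ 1 / 4 + |L| * ‖fderiv ℝ f x‖ := hf.bobkovIntegrand_le (abs_nonneg L) x
    _ ≤ 1 / 4 + |L| * K := by gcongr; exact hK x

end IsTestFunction

variable [MeasurableSpace E] {μ : Measure E} {s : ℝ}

lemma DefectiveBobkov.defect_nonneg (h : DefectiveBobkov μ L s) : 0 ≤ s := by
  simpa [bobkovIntegrand] using h _ (.const (left_mem_Icc.2 zero_le_one))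

lemma defectiveBobkov_zero_of_subsingleton [Subsingleton E] [IsProbabilityMeasure μ] :
    DefectiveBobkov μ L 0 := by
  intro f _
  have hf : f = fun _ => f 0 := funext fun x => congrArg f (Subsingleton.elim x 0)
  rw [hf]
  simpa [bobkovIntegrand] using (le_abs_self _).trans (abs_le_sqrt_sq_add_sq (f 0 * (1 - f 0)) 0)

end TestFunction

section Line

variable {f ρ : ℝ → ℝ} {a b L M : ℝ}

lemma mul_one_sub_add_sq_mem_Icc {p c : ℝ} (hp : p ∈ Icc (0 : ℝ) 1) (hc : c ∈ Icc (0 : ℝ) 1) :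
    p * (1 - p) + (p - c) ^ 2 ∈ Icc (0 : ℝ) 1 := by
  refine ⟨add_nonneg (mul_one_sub_mem_Icc hp).1 (sq_nonneg _), ?_⟩
  obtain ⟨⟨hp0, hp1⟩, hc0, hc1⟩ := And.intro hp hc
  nlinarith [mul_nonneg hp0 hc0, mul_nonneg (sub_nonneg.2 hp1) (sub_nonneg.2 hc1)]

lemma integral_mul_one_sub_integral_le {α : Type*} [MeasurableSpace α] {μ : Measure α}
    [IsProbabilityMeasure μ] {f : α → ℝ} (hf : Integrable f μ) (c : ℝ) :
    (∫ x, f x ∂μ) * (1 - ∫ x, f x ∂μ) ≤ ∫ x, (f x * (1 - f x) + (f x - c) ^ 2) ∂μ := by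
  have affine (y : ℝ) : y * (1 - y) + (y - c) ^ 2 = (1 - 2 * c) * y + c ^ 2 := by ring
  simp only [affine]
  rw [integral_add (hf.const_mul _) (integrable_const _), integral_const_mul,
    integral_const, probReal_univ, one_smul, ← affine]
  exact le_add_of_nonneg_right (sq_nonneg _)

lemma integral_sq_sub_mul_eq (hf : ContDiff ℝ 1 f) (hρ : Continuous ρ) :
    ∫ x in a..b, (f x - f a) ^ 2 * ρ x
      = 2 * ∫ x in a..b, (f x - f a) * deriv f x * ∫ y in x..b, ρ y := by
  have hsq (x : ℝ) : HasDerivAt (fun x => (f x - f a) ^ 2) (2 * (f x - f a) * deriv f x) x := by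
    simpa using ((hf.differentiable one_ne_zero x).hasDerivAt.sub_const (f a)).fun_pow 2
  have htail (x : ℝ) : HasDerivAt (fun x => -∫ y in x..b, ρ y) (ρ x) x := by
    simpa using (intervalIntegral.integral_hasDerivAt_left (hρ.intervalIntegrable x b)
      (hρ.stronglyMeasurableAtFilter _ _) hρ.continuousAt).fun_neg
  have hfc := hf.continuous
  rw [intervalIntegral.integral_mul_deriv_eq_deriv_mul (fun x _ => hsq x) (fun x _ => htail x)
    (Continuous.intervalIntegrable (by fun_prop) _ _) (hρ.intervalIntegrable _ _)]
  simp [mul_assoc]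

lemma add_sub_sq_le_sqrt {a b g : ℝ} (ha : a ∈ Icc (0 : ℝ) (1 / 4)) (hg : |g| ≤ 1) :
    a + 4 * (|g| * |b|) - g ^ 2 ≤ √(a ^ 2 + (5 * b) ^ 2) := by
  set m := 4 * (|g| * |b|) - g ^ 2 with hm
  have hm_sq : m ≤ 4 * b ^ 2 := by nlinarith [sq_nonneg (|g| - 2 * |b|), sq_abs g, sq_abs b]
  have hm_abs : m ≤ 4 * |b| := by nlinarith [sq_nonneg g, abs_nonneg b]
  rw [add_sub_assoc, ← hm]
  rcases le_or_gt m 0 with hm0 | hm0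
  · linarith [abs_le_sqrt_sq_add_sq a (5 * b), le_abs_self a]
  · apply Real.le_sqrt_of_sq_le
    nlinarith [mul_nonneg hm0.le (sub_nonneg.2 ha.2), mul_self_le_mul_self hm0.le hm_abs, sq_abs b]

lemma IsTestFunction.mul_add_cross_sub_sq_le (hf : IsTestFunction f) (a : ℝ) {x w r : ℝ}
    (hw : 0 ≤ w) (hr : 0 ≤ r) (hrw : r ≤ L * w) :
    f x * (1 - f x) * w + 4 * ((f x - f a) * deriv f x * r) - (f x - f a) ^ 2 * w
      ≤ bobkovIntegrand (5 * L) f x * w := by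
  have hcross : (f x - f a) * deriv f x * r ≤ |f x - f a| * |L * deriv f x| * w :=
    calc (f x - f a) * deriv f x * r ≤ |f x - f a| * |deriv f x| * (L * w) := by
          rw [← abs_mul]
          exact mul_le_mul (le_abs_self _) hrw hr (abs_nonneg _)
      _ ≤ |f x - f a| * |deriv f x| * (|L| * w) := by
          gcongr
          exact le_abs_self L
      _ = |f x - f a| * |L * deriv f x| * w := by rw [abs_mul]; ring
  calc f x * (1 - f x) * w + 4 * ((f x - f a) * deriv f x * r) - (f x - f a) ^ 2 * w
      ≤ (f x * (1 - f x) + 4 * (|f x - f a| * |L * deriv f x|) - (f x - f a) ^ 2) * w := by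
        linarith
    _ ≤ √((f x * (1 - f x)) ^ 2 + (5 * (L * deriv f x)) ^ 2) * w :=
        mul_le_mul_of_nonneg_right (add_sub_sq_le_sqrt (mul_one_sub_mem_Icc (hf.mem_Icc x))
          (hf.norm_sub_le_one x a)) hw
    _ = bobkovIntegrand (5 * L) f x * w := by
        rw [bobkovIntegrand, ← norm_deriv_eq_norm_fderiv, Real.norm_eq_abs, mul_pow _ |_|,
          sq_abs, ← mul_pow, mul_assoc]

lemma integral_add_sq_sub_mul_le (hf : IsTestFunction f) (hρ : Continuous ρ)
    (hρ0 : ∀ x, 0 ≤ ρ x) (hab : a ≤ b) (htail : ∀ x ∈ Icc a b, ∫ y in x..b, ρ y ≤ L * ρ x) :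
    ∫ x in a..b, (f x * (1 - f x) + (f x - f a) ^ 2) * ρ x
      ≤ ∫ x in a..b, bobkovIntegrand (5 * L) f x * ρ x := by
  have hfc := hf.continuous
  have hf' := hf.contDiff.continuous_deriv le_rfl
  have hJρ : IntervalIntegrable (fun x => (f x * (1 - f x)) * ρ x) volume a b :=
    Continuous.intervalIntegrable (by fun_prop) a b
  have hsq : IntervalIntegrable (fun x => (f x - f a) ^ 2 * ρ x) volume a b :=
    Continuous.intervalIntegrable (by fun_prop) a b
  have hR : Continuous fun x => ∫ y in x..b, ρ y := by
    simp_rw [intervalIntegral.integral_symm b]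
    exact (intervalIntegral.continuous_primitive (fun _ _ => hρ.intervalIntegrable _ _) b).neg
  have hcross : IntervalIntegrable (fun x => (f x - f a) * deriv f x * ∫ y in x..b, ρ y)
      volume a b := Continuous.intervalIntegrable (by fun_prop) a b
  -- The square term is written as twice itself minus itself, and only the former is integrated by
  -- parts: the latter is what absorbs the resulting cross term.
  calc ∫ x in a..b, (f x * (1 - f x) + (f x - f a) ^ 2) * ρ x
      = ∫ x in a..b, ((f x * (1 - f x)) * ρ x
          + 4 * ((f x - f a) * deriv f x * ∫ y in x..b, ρ y) - (f x - f a) ^ 2 * ρ x) := by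
        rw [intervalIntegral.integral_sub (hJρ.add (hcross.const_mul 4)) hsq,
          intervalIntegral.integral_add hJρ (hcross.const_mul 4),
          intervalIntegral.integral_const_mul]
        simp only [add_mul]
        rw [intervalIntegral.integral_add hJρ hsq]
        linarith [integral_sq_sub_mul_eq (a := a) (b := b) hf.contDiff hρ]
    _ ≤ ∫ x in a..b, bobkovIntegrand (5 * L) f x * ρ x := by
        refine intervalIntegral.integral_mono_on hab ((hJρ.add (hcross.const_mul 4)).sub hsq)
          ((hf.continuous_bobkovIntegrand.mul hρ).intervalIntegrable a b) fun x hx => ?_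
        exact hf.mul_add_cross_sub_sq_le a (hρ0 x)
          (intervalIntegral.integral_nonneg hx.2 fun y _ => hρ0 y) (htail x hx)

lemma bobkovIntegrand_comp_neg (f : ℝ → ℝ) (x : ℝ) :
    bobkovIntegrand L (f ∘ Neg.neg) x = bobkovIntegrand L f (-x) := by
  have hderiv : deriv (f ∘ Neg.neg) x = -deriv f (-x) := deriv_comp_neg f x
  simp [bobkovIntegrand, ← norm_deriv_eq_norm_fderiv, hderiv]

lemma integral_add_sq_sub_mul_le_symm (hf : IsTestFunction f) (hρ : Continuous ρ)
    (hρ0 : ∀ x, 0 ≤ ρ x) (heven : ρ.Even) (hM : 0 ≤ M)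
    (htail : ∀ x ∈ Icc 0 M, ∫ y in x..M, ρ y ≤ L * ρ x) :
    ∫ x in -M..M, (f x * (1 - f x) + (f x - f 0) ^ 2) * ρ x
      ≤ ∫ x in -M..M, bobkovIntegrand (5 * L) f x * ρ x := by
  have hsplit {g : ℝ → ℝ} (hg : Continuous g) :
      ∫ x in -M..M, g x = (∫ x in 0..M, g (-x)) + ∫ x in 0..M, g x := by
    rw [intervalIntegral.integral_comp_neg, neg_zero,
      intervalIntegral.integral_add_adjacent_intervals (hg.intervalIntegrable _ _)
        (hg.intervalIntegrable _ _)]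
  have hfc := hf.continuous
  have hbob := hf.continuous_bobkovIntegrand (L := 5 * L)
  have hfneg : IsTestFunction (f ∘ Neg.neg) := hf.comp contDiff_neg (LipschitzWith.id.neg)
  rw [hsplit (by fun_prop), hsplit (by fun_prop)]
  refine add_le_add ?_ (integral_add_sq_sub_mul_le hf hρ hρ0 hM htail)
  simpa [heven _, bobkovIntegrand_comp_neg] using
    integral_add_sq_sub_mul_le hfneg hρ hρ0 hM htail

theorem defectiveBobkov_of_integral_le {μ : Measure ℝ} [IsProbabilityMeasure μ]
    (hμ : μ = volume.withDensity fun x => ENNReal.ofReal (ρ x)) (hρ : Continuous ρ)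
    (hρ0 : ∀ x, 0 ≤ ρ x) (heven : ρ.Even) (hM : 0 ≤ M)
    (htail : ∀ x ∈ Icc 0 M, ∫ y in x..M, ρ y ≤ L * ρ x) :
    DefectiveBobkov μ (5 * L) (μ.real (Ioc (-M) M)ᶜ) := by
  intro f hf
  have hfc := hf.continuous
  have setIntegral_eq (g : ℝ → ℝ) :
      ∫ x in Ioc (-M) M, g x ∂μ = ∫ x in -M..M, g x * ρ x := by
    rw [hμ, setIntegral_withDensity_eq_setIntegral_toReal_smul (by fun_prop)
      (.of_forall fun _ => ENNReal.ofReal_lt_top) _ measurableSet_Ioc,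
      intervalIntegral.integral_of_le (by linarith)]
    simp only [ENNReal.toReal_ofReal (hρ0 _), smul_eq_mul, mul_comm]
  set G : ℝ → ℝ := fun x => f x * (1 - f x) + (f x - f 0) ^ 2
  have hG_mem (x : ℝ) : G x ∈ Icc 0 1 :=
    mul_one_sub_add_sq_mem_Icc (hf.mem_Icc x) (hf.mem_Icc 0)
  have hG_int : Integrable G μ := .of_bound (by fun_prop) 1 (.of_forall fun x => by
    rw [Real.norm_of_nonneg (hG_mem x).1]; exact (hG_mem x).2)
  calc (∫ x, f x ∂μ) * (1 - ∫ x, f x ∂μ) ≤ ∫ x, G x ∂μ :=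
        integral_mul_one_sub_integral_le hf.integrable (f 0)
    _ = ∫ x in Ioc (-M) M, G x ∂μ + ∫ x in (Ioc (-M) M)ᶜ, G x ∂μ :=
        (integral_add_compl measurableSet_Ioc hG_int).symm
    _ ≤ ∫ x in Ioc (-M) M, bobkovIntegrand (5 * L) f x ∂μ + μ.real (Ioc (-M) M)ᶜ := by
        refine add_le_add ?_ ?_
        · rw [setIntegral_eq, setIntegral_eq]
          exact integral_add_sq_sub_mul_le_symm hf hρ hρ0 heven hM htail
        · calc ∫ x in (Ioc (-M) M)ᶜ, G x ∂μ ≤ ∫ _ in (Ioc (-M) M)ᶜ, 1 ∂μ :=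
                setIntegral_mono hG_int.integrableOn (integrable_const 1).integrableOn
                  fun x => (hG_mem x).2
            _ = μ.real (Ioc (-M) M)ᶜ := by simp
    _ ≤ ∫ x, bobkovIntegrand (5 * L) f x ∂μ + μ.real (Ioc (-M) M)ᶜ :=
        add_le_add (setIntegral_le_integral hf.integrable_bobkovIntegrand
          (.of_forall bobkovIntegrand_nonneg)) le_rfl

end Line

section Tensorization

lemma sqrt_integral_sq_add_integral_sq_le {α : Type*} [MeasurableSpace α] {μ : Measure α}
    {a b : α → ℝ} (ha : Integrable a μ) (hb : Integrable b μ) :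
    √((∫ x, a x ∂μ) ^ 2 + (∫ x, b x ∂μ) ^ 2) ≤ ∫ x, √(a x ^ 2 + b x ^ 2) ∂μ := by
  have h := norm_integral_le_integral_norm (μ := μ)
    (fun x => (a x : ℂ) + (b x : ℂ) * Complex.I)
  rw [integral_add ha.ofReal (hb.ofReal.mul_const _), integral_mul_const] at h
  simpa only [integral_complex_ofReal, Complex.norm_add_mul_I] using h

lemma sqrt_add_sq_add_sq_le {a s : ℝ} (b : ℝ) (hs : 0 ≤ s) :
    √((a + s) ^ 2 + b ^ 2) ≤ √(a ^ 2 + b ^ 2) + s := by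
  have ha := (le_abs_self a).trans (abs_le_sqrt_sq_add_sq a b)
  rw [Real.sqrt_le_left (by positivity), add_sq (√_), Real.sq_sqrt (by positivity)]
  nlinarith [mul_le_mul_of_nonneg_right ha hs]

section Prod

open ContinuousLinearMap (inl inr)

variable {E F : Type*} [NormedAddCommGroup E] [NormedSpace ℝ E]
  [NormedAddCommGroup F] [NormedSpace ℝ F] {f : E × F → ℝ} {L : ℝ}

/-- The analogue of `bobkovIntegrand` on a product, with the Euclidean combination of the norms of
the two partial derivatives as the length of the gradient, whatever the norm on `E × F`. -/
noncomputable def prodBobkovIntegrand (L : ℝ) (f : E × F → ℝ) (z : E × F) : ℝ :=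
  √((f z * (1 - f z)) ^ 2
    + ((L * ‖fderiv ℝ f z ∘L inl ℝ E F‖) ^ 2 + (L * ‖fderiv ℝ f z ∘L inr ℝ E F‖) ^ 2))

lemma norm_comp_inl_le (l : E × F →L[ℝ] ℝ) : ‖l ∘L inl ℝ E F‖ ≤ ‖l‖ :=
  (l.opNorm_comp_le _).trans
    (mul_le_of_le_one_right (norm_nonneg l) (ContinuousLinearMap.norm_inl_le_one ℝ E F))

lemma norm_comp_inr_le (l : E × F →L[ℝ] ℝ) : ‖l ∘L inr ℝ E F‖ ≤ ‖l‖ :=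
  (l.opNorm_comp_le _).trans
    (mul_le_of_le_one_right (norm_nonneg l) (ContinuousLinearMap.norm_inr_le_one ℝ E F))

namespace IsTestFunction

variable (hf : IsTestFunction f)
include hf

lemma prodMk_left (x : E) : IsTestFunction fun y => f (x, y) :=
  hf.comp (contDiff_prodMk_right x) (LipschitzWith.prodMk_left x)

lemma hasFDerivAt_prodMk_left (x : E) (y : F) :
    HasFDerivAt (fun x => f (x, y)) (fderiv ℝ f (x, y) ∘L inl ℝ E F) x :=
  (hf.differentiable (x, y)).hasFDerivAt.comp x (_root_.hasFDerivAt_prodMk_left x y)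

lemma hasFDerivAt_prodMk_right (x : E) (y : F) :
    HasFDerivAt (fun y => f (x, y)) (fderiv ℝ f (x, y) ∘L inr ℝ E F) y :=
  (hf.differentiable (x, y)).hasFDerivAt.comp y (_root_.hasFDerivAt_prodMk_right x y)

lemma exists_norm_fderiv_comp_inl_le :
    ∃ K : ℝ, ∀ x y, ‖fderiv ℝ f (x, y) ∘L inl ℝ E F‖ ≤ K :=
  hf.exists_norm_fderiv_le.imp fun _ hK x y => (norm_comp_inl_le _).trans (hK (x, y))

lemma continuous_fderiv_comp_inl :
    Continuous fun z => fderiv ℝ f z ∘L inl ℝ E F :=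
  hf.continuous_fderiv.clm_comp continuous_const

lemma continuous_fderiv_comp_inr :
    Continuous fun z => fderiv ℝ f z ∘L inr ℝ E F :=
  hf.continuous_fderiv.clm_comp continuous_const

variable [MeasurableSpace F] [OpensMeasurableSpace F] [SecondCountableTopology F]
  {ν : Measure F}

lemma integrable_fderiv_comp_inl [IsFiniteMeasure ν] (x : E) :
    Integrable (fun y => fderiv ℝ f (x, y) ∘L inl ℝ E F) ν := by
  obtain ⟨K, hK⟩ := hf.exists_norm_fderiv_comp_inl_le
  exact .of_bound (hf.continuous_fderiv_comp_inl.comp (.prodMk_right x)).aestronglyMeasurable K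
    (.of_forall (hK x))

lemma hasFDerivAt_integral [IsFiniteMeasure ν] (x : E) :
    HasFDerivAt (fun x => ∫ y, f (x, y) ∂ν) (∫ y, fderiv ℝ f (x, y) ∘L inl ℝ E F ∂ν) x := by
  obtain ⟨K, hK⟩ := hf.exists_norm_fderiv_comp_inl_le
  exact hasFDerivAt_integral_of_dominated_of_fderiv_le univ_mem
    (.of_forall fun x => (hf.prodMk_left x).continuous.aestronglyMeasurable)
    (hf.prodMk_left x).integrable (hf.integrable_fderiv_comp_inl x).aestronglyMeasurable
    (.of_forall fun y x _ => hK x y) (integrable_const K)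
    (.of_forall fun y x _ => hf.hasFDerivAt_prodMk_left x y)

lemma integral_right [IsProbabilityMeasure ν] : IsTestFunction fun x => ∫ y, f (x, y) ∂ν where
  contDiff := by
    obtain ⟨K, hK⟩ := hf.exists_norm_fderiv_comp_inl_le
    refine contDiff_one_iff_hasFDerivAt.2 ⟨_, ?_, hf.hasFDerivAt_integral⟩
    exact continuous_of_dominated
      (fun x => (hf.integrable_fderiv_comp_inl x).aestronglyMeasurable)
      (fun x => .of_forall (hK x)) (integrable_const K)
      (.of_forall fun y => hf.continuous_fderiv_comp_inl.comp (.prodMk_left y))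
  lipschitz := by
    obtain ⟨K, hK⟩ := hf.lipschitz
    refine ⟨K, .of_dist_le_mul fun x x' => ?_⟩
    have hdist (y : F) : ‖f (x, y) - f (x', y)‖ ≤ K * dist x x' := by
      simpa [Prod.dist_eq, dist_eq_norm] using hK.dist_le_mul (x, y) (x', y)
    rw [dist_eq_norm, ← integral_sub (hf.prodMk_left x).integrable (hf.prodMk_left x').integrable]
    simpa using norm_integral_le_of_norm_le_const (μ := ν) (.of_forall hdist)
  mem_Icc x := (hf.prodMk_left x).integral_mem_Icc

lemma bobkovIntegrand_integral_le [IsProbabilityMeasure ν] {s : ℝ} (hν : DefectiveBobkov ν L s)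
    (x : E) :
    bobkovIntegrand L (fun x => ∫ y, f (x, y) ∂ν) x
      ≤ ∫ y, prodBobkovIntegrand L f (x, y) ∂ν + s := by
  have hsec := hf.prodMk_left x
  set b := bobkovIntegrand L fun y => f (x, y)
  have hb (y : F) : b y ^ 2 = (f (x, y) * (1 - f (x, y))) ^ 2
      + (L * ‖fderiv ℝ f (x, y) ∘L inr ℝ E F‖) ^ 2 := by
    rw [← (hf.hasFDerivAt_prodMk_right x y).fderiv]
    exact Real.sq_sqrt (by positivity)
  have hD : Integrable (fun y => L * ‖fderiv ℝ f (x, y) ∘L inl ℝ E F‖) ν :=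
    (hf.integrable_fderiv_comp_inl x).norm.const_mul L
  have hgrad : (L * ‖fderiv ℝ (fun x => ∫ y, f (x, y) ∂ν) x‖) ^ 2
      ≤ (∫ y, L * ‖fderiv ℝ f (x, y) ∘L inl ℝ E F‖ ∂ν) ^ 2 := by
    rw [(hf.hasFDerivAt_integral x).fderiv, integral_const_mul, mul_pow, mul_pow]
    gcongr
    exact norm_integral_le_integral_norm _
  calc bobkovIntegrand L (fun x => ∫ y, f (x, y) ∂ν) x
      ≤ √((∫ y, b y ∂ν + s) ^ 2 + (∫ y, L * ‖fderiv ℝ f (x, y) ∘L inl ℝ E F‖ ∂ν) ^ 2) :=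
        Real.sqrt_le_sqrt (add_le_add (pow_le_pow_left₀
          (mul_one_sub_mem_Icc hsec.integral_mem_Icc).1 (hν _ hsec) 2) hgrad)
    _ ≤ √((∫ y, b y ∂ν) ^ 2 + (∫ y, L * ‖fderiv ℝ f (x, y) ∘L inl ℝ E F‖ ∂ν) ^ 2) + s :=
        sqrt_add_sq_add_sq_le _ hν.defect_nonneg
    _ ≤ ∫ y, √(b y ^ 2 + (L * ‖fderiv ℝ f (x, y) ∘L inl ℝ E F‖) ^ 2) ∂ν + s :=
        add_le_add_left (sqrt_integral_sq_add_integral_sq_le hsec.integrable_bobkovIntegrand hD) s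
    _ = ∫ y, prodBobkovIntegrand L f (x, y) ∂ν + s := by
        simp only [hb, prodBobkovIntegrand, add_right_comm, add_assoc]

end IsTestFunction

variable [MeasurableSpace E] [OpensMeasurableSpace E] [MeasurableSpace F] [OpensMeasurableSpace F]
  [SecondCountableTopology F] {μ : Measure E} {ν : Measure F}

lemma IsTestFunction.integrable_prodBobkovIntegrand [IsFiniteMeasure μ] [IsFiniteMeasure ν]
    (hf : IsTestFunction f) : Integrable (prodBobkovIntegrand L f) (μ.prod ν) := by
  have hcont : Continuous (prodBobkovIntegrand L f) := by
    have := hf.continuous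
    have := hf.continuous_fderiv_comp_inl
    have := hf.continuous_fderiv_comp_inr
    unfold prodBobkovIntegrand
    fun_prop
  refine (hf.integrable_bobkovIntegrand (L := 2 * L)).mono' hcont.aestronglyMeasurable
    (.of_forall fun z => ?_)
  rw [prodBobkovIntegrand, Real.norm_of_nonneg (Real.sqrt_nonneg _)]
  have hinl := mul_le_mul_of_nonneg_left
    (pow_le_pow_left₀ (norm_nonneg _) (norm_comp_inl_le (fderiv ℝ f z)) 2) (sq_nonneg L)
  have hinr := mul_le_mul_of_nonneg_left
    (pow_le_pow_left₀ (norm_nonneg _) (norm_comp_inr_le (fderiv ℝ f z)) 2) (sq_nonneg L)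
  refine Real.sqrt_le_sqrt ((add_le_add_iff_left _).2 ?_)
  simp only [mul_pow]
  linarith [mul_nonneg (sq_nonneg L) (sq_nonneg ‖fderiv ℝ f z‖)]

theorem DefectiveBobkov.prod [IsProbabilityMeasure μ] [IsProbabilityMeasure ν] {s₁ s₂ : ℝ}
    (hμ : DefectiveBobkov μ L s₁) (hν : DefectiveBobkov ν L s₂) (hf : IsTestFunction f) :
    (∫ z, f z ∂μ.prod ν) * (1 - ∫ z, f z ∂μ.prod ν)
      ≤ ∫ z, prodBobkovIntegrand L f z ∂μ.prod ν + (s₁ + s₂) := by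
  have hg : IsTestFunction fun x => ∫ y, f (x, y) ∂ν := hf.integral_right
  have hZ := hf.integrable_prodBobkovIntegrand (L := L) (μ := μ) (ν := ν)
  rw [integral_prod _ hf.integrable, integral_prod _ hZ]
  calc (∫ x, ∫ y, f (x, y) ∂ν ∂μ) * (1 - ∫ x, ∫ y, f (x, y) ∂ν ∂μ)
      ≤ ∫ x, bobkovIntegrand L (fun x => ∫ y, f (x, y) ∂ν) x ∂μ + s₁ := hμ _ hg
    _ ≤ ∫ x, (∫ y, prodBobkovIntegrand L f (x, y) ∂ν + s₂) ∂μ + s₁ :=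
        add_le_add_left (integral_mono hg.integrable_bobkovIntegrand
          (hZ.integral_prod_left.add (integrable_const _))
          (hf.bobkovIntegrand_integral_le hν)) s₁
    _ = ∫ x, ∫ y, prodBobkovIntegrand L f (x, y) ∂ν ∂μ + (s₁ + s₂) := by
        rw [integral_add hZ.integral_prod_left (integrable_const _), integral_const, probReal_univ,
          one_smul]
        ring

end Prod

section Euclidean

variable {n : ℕ}

/-- Splitting off the first coordinate of a Euclidean space. The product carries the sup norm, so
this is not an isometry. -/
noncomputable def consEquiv (n : ℕ) :
    (ℝ × EuclideanSpace ℝ (Fin n)) ≃L[ℝ] EuclideanSpace ℝ (Fin (n + 1)) :=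
  ((ContinuousLinearEquiv.refl ℝ ℝ).prodCongr (EuclideanSpace.equiv (Fin n) ℝ)).trans
    ((Fin.consEquivL ℝ fun _ => ℝ).trans (EuclideanSpace.equiv (Fin (n + 1)) ℝ).symm)

lemma consEquiv_apply (z : ℝ × EuclideanSpace ℝ (Fin n)) :
    consEquiv n z = WithLp.toLp 2 (Fin.cons z.1 z.2.ofLp) :=
  rfl

lemma sq_norm_eq_comp_consEquiv (l : EuclideanSpace ℝ (Fin (n + 1)) →L[ℝ] ℝ) :
    ‖l‖ ^ 2 = ‖l ∘L (consEquiv n).toContinuousLinearMap ∘L .inl ℝ ℝ (EuclideanSpace ℝ (Fin n))‖ ^ 2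
      + ‖l ∘L (consEquiv n).toContinuousLinearMap ∘L
          .inr ℝ ℝ (EuclideanSpace ℝ (Fin n))‖ ^ 2 := by
  have hinl : consEquiv n (1, 0) = EuclideanSpace.single 0 1 := by
    ext j
    refine Fin.cases ?_ (fun j => ?_) j <;> simp [consEquiv_apply]
  have hinr (i : Fin n) :
      consEquiv n (0, EuclideanSpace.single i 1) = EuclideanSpace.single i.succ 1 := by
    ext j
    refine Fin.cases ?_ (fun j => ?_) j <;> simp [consEquiv_apply, Pi.single_apply]
  rw [(EuclideanSpace.basisFun _ ℝ).norm_dual, (EuclideanSpace.basisFun _ ℝ).norm_dual,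
    (OrthonormalBasis.singleton Unit ℝ).norm_dual, Fin.sum_univ_succ]
  simp [hinl, hinr]

instance isProbabilityMeasure_prodMeasure (μ : Measure ℝ) [IsProbabilityMeasure μ] :
    IsProbabilityMeasure (prodMeasure μ n) :=
  Measure.isProbabilityMeasure_map (MeasurableEquiv.measurable _).aemeasurable

lemma measurePreserving_consEquiv (μ : Measure ℝ) [IsProbabilityMeasure μ] :
    MeasurePreserving (consEquiv n) (μ.prod (prodMeasure μ n)) (prodMeasure μ (n + 1)) := by
  have htoLp (k : ℕ) : MeasurePreserving (MeasurableEquiv.toLp 2 (Fin k → ℝ))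
      (Measure.pi fun _ => μ) (prodMeasure μ k) := ⟨MeasurableEquiv.measurable _, rfl⟩
  have hcons := (measurePreserving_piFinSuccAbove (fun _ : Fin (n + 1) => μ) 0).symm
  convert (htoLp (n + 1)).comp (hcons.comp ((MeasurePreserving.id μ).prod (htoLp n).symm))
  funext z
  simp [consEquiv_apply, MeasurableEquiv.piFinSuccAbove, Fin.consEquiv]

theorem DefectiveBobkov.prodMeasure {μ : Measure ℝ} [IsProbabilityMeasure μ] {L s : ℝ}
    (h : DefectiveBobkov μ L s) (n : ℕ) : DefectiveBobkov (prodMeasure μ n) L (n * s) := by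
  induction n with
  | zero => simpa using defectiveBobkov_zero_of_subsingleton
  | succ n ih =>
    intro f hf
    have hcons : IsTestFunction (f ∘ consEquiv n) :=
      hf.comp (consEquiv n).contDiff (consEquiv n).toContinuousLinearMap.lipschitz
    have hemb : MeasurableEmbedding (consEquiv n) :=
      (consEquiv n).toHomeomorph.measurableEmbedding
    have hgrad (z : ℝ × EuclideanSpace ℝ (Fin n)) :
        prodBobkovIntegrand L (f ∘ consEquiv n) z = bobkovIntegrand L f (consEquiv n z) := by
      rw [prodBobkovIntegrand, (consEquiv n).comp_right_fderiv, bobkovIntegrand]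
      simp only [mul_pow, sq_norm_eq_comp_consEquiv (n := n) (fderiv ℝ f _), mul_add]
      rfl
    have hprod := h.prod ih hcons
    simp only [hgrad] at hprod
    rw [← (measurePreserving_consEquiv μ).integral_comp hemb,
      ← (measurePreserving_consEquiv μ).integral_comp hemb]
    simpa [add_mul, add_comm] using hprod

end Euclidean

end Tensorization

section Cheeger

variable {E : Type*} [NormedAddCommGroup E] [NormedSpace ℝ E]

lemma exists_isTestFunction_of_lipschitzWith [FiniteDimensional ℝ E] {u : E → ℝ} {K : NNReal}
    (hu : LipschitzWith K u) (hu01 : ∀ x, u x ∈ Icc (0 : ℝ) 1) {r : ℝ} (hr : 0 < r) :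
    ∃ f, IsTestFunction f ∧ LipschitzWith K f ∧
      ∀ x p, (∀ y ∈ Metric.ball x r, u y = p) → f x = p := by
  borelize E
  let vol : Measure E := Measure.addHaar
  let φ : ContDiffBump (0 : E) := ⟨r / 2, r, half_pos hr, half_lt_self hr⟩
  let f : E → ℝ := convolution (φ.normed vol) u (ContinuousLinearMap.lsmul ℝ ℝ) vol
  have hf (x : E) : f x = ∫ t, φ.normed vol t * u (x - t) ∂vol := rfl
  have hfi (x : E) : Integrable (fun t => φ.normed vol t * u (x - t)) vol := by
    have := hu.continuous
    refine φ.integrable_normed.mul_bdd (c := 1) (by fun_prop) (.of_forall fun t => ?_)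
    exact abs_le.2 ⟨by linarith [(hu01 (x - t)).1], (hu01 (x - t)).2⟩
  have hlip : LipschitzWith K f := .of_dist_le_mul fun x y => by
    rw [dist_eq_norm, hf, hf, ← integral_sub (hfi x) (hfi y)]
    calc ‖∫ t, (φ.normed vol t * u (x - t) - φ.normed vol t * u (y - t)) ∂vol‖
        ≤ ∫ t, φ.normed vol t * (K * dist x y) ∂vol := by
          refine norm_integral_le_of_norm_le (φ.integrable_normed.mul_const _)
            (.of_forall fun t => ?_)
          rw [← mul_sub, norm_mul, Real.norm_of_nonneg (φ.nonneg_normed t), ← dist_eq_norm]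
          gcongr
          · exact φ.nonneg_normed t
          · simpa using hu.dist_le_mul (x - t) (y - t)
      _ = K * dist x y := by rw [integral_mul_const, φ.integral_normed, one_mul]
  refine ⟨f, ⟨?_, ⟨K, hlip⟩, fun x => ⟨?_, ?_⟩⟩, hlip, fun x p hp => ?_⟩
  · exact φ.hasCompactSupport_normed.contDiff_convolution_left _ φ.contDiff_normed
      hu.continuous.locallyIntegrable
  · exact integral_nonneg fun t => mul_nonneg (φ.nonneg_normed t) (hu01 _).1
  · rw [hf, ← φ.integral_normed (μ := vol)]
    exact integral_mono (hfi x) φ.integrable_normed fun t =>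
      mul_le_of_le_one_right (φ.nonneg_normed t) (hu01 _).2
  · have hpx : u x = p := hp x (Metric.mem_ball_self hr)
    exact (φ.normed_convolution_eq_right fun y hy => (hp y hy).trans hpx.symm).trans hpx

lemma exists_isTestFunction_cutoff [FiniteDimensional ℝ E] {A : Set E} (hA : A.Nonempty) {h : ℝ}
    (hh : 0 < h) :
    ∃ f, IsTestFunction f ∧ (∀ x, ‖fderiv ℝ f x‖ ≤ 2 / h) ∧ (∀ x ∈ A, f x = 1) ∧
      ∀ x ∉ Metric.cthickening h A, f x = 0 := by
  let u (x : E) : ℝ := max 0 (min 1 (3 / 2 - 2 / h * Metric.infDist x A))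
  have hdist (x y : E) := abs_le.1 ((Metric.lipschitz_infDist_pt A).dist_le_mul x y)
  simp only [NNReal.coe_one, one_mul] at hdist
  have hu : LipschitzWith (2 / h).toNNReal u := by
    refine LipschitzWith.const_max (LipschitzWith.const_min (.of_dist_le_mul fun x y => ?_) 1) 0
    rw [Real.coe_toNNReal _ (by positivity), Real.dist_eq, sub_sub_sub_cancel_left, ← mul_sub,
      abs_mul, abs_of_pos (by positivity : 0 < 2 / h), abs_sub_comm]
    gcongr
    exact abs_le.2 (hdist x y)
  obtain ⟨f, hf, hflip, hfu⟩ := exists_isTestFunction_of_lipschitzWith hu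
    (fun x => ⟨le_max_left _ _, max_le zero_le_one (min_le_left _ _)⟩) (r := h / 4) (by positivity)
  refine ⟨f, hf, fun x => ?_, fun x hx => hfu x 1 fun y hy => ?_,
    fun x hx => hfu x 0 fun y hy => ?_⟩
  · exact (norm_fderiv_le_of_lipschitz ℝ hflip).trans_eq (Real.coe_toNNReal _ (by positivity))
  · have hy' : 2 / h * Metric.infDist y A ≤ 1 / 2 := by
      rw [div_mul_eq_mul_div, div_le_iff₀ hh]
      linarith [Metric.infDist_le_dist_of_mem (x := y) hx, Metric.mem_ball.1 hy]
    simp only [u]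
    rw [min_eq_left (by linarith), max_eq_right zero_le_one]
  · have hx' : h < Metric.infDist x A := by
      by_contra! hle
      refine hx (Metric.mem_cthickening_iff.2 ?_)
      exact (ENNReal.le_ofReal_iff_toReal_le (Metric.infEDist_ne_top hA) hh.le).2 hle
    have hy' : 3 / 2 ≤ 2 / h * Metric.infDist y A := by
      rw [div_mul_eq_mul_div, le_div_iff₀ hh]
      linarith [(hdist y x).1, Metric.mem_ball.1 hy]
    exact max_eq_left ((min_le_right _ _).trans (by linarith))

namespace IsTestFunction

variable [MeasurableSpace E] [OpensMeasurableSpace E] {ν : Measure E} [IsFiniteMeasure ν]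
  {f : E → ℝ} {A B : Set E} (hf : IsTestFunction f)
include hf

lemma measureReal_le_integral (hA : MeasurableSet A) (hfA : ∀ x ∈ A, f x = 1) :
    ν.real A ≤ ∫ x, f x ∂ν := by
  rw [← integral_indicator_one hA]
  exact integral_mono ((integrable_const 1).indicator hA) hf.integrable
    (indicator_le' (fun x hx => (hfA x hx).ge) fun x _ => (hf.mem_Icc x).1)

lemma integral_le_measureReal (hB : MeasurableSet B) (hfB : ∀ x ∉ B, f x = 0) :
    ∫ x, f x ∂ν ≤ ν.real B := by
  rw [← integral_indicator_one hB]
  exact integral_mono hf.integrable ((integrable_const 1).indicator hB)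
    (le_indicator (fun x _ => (hf.mem_Icc x).2) fun x hx => (hfB x hx).le)

omit [MeasurableSpace E] in
lemma bobkovIntegrand_eq_zero {L : ℝ} {x : E} (hx : f x = 0 ∨ f x = 1) :
    bobkovIntegrand L f x = 0 := by
  have hfderiv : fderiv ℝ f x = 0 := by
    rcases hx with hx | hx
    · exact IsLocalMin.fderiv_eq_zero (.of_forall fun y => hx ▸ (hf.mem_Icc y).1)
    · exact IsLocalMax.fderiv_eq_zero (.of_forall fun y => hx ▸ (hf.mem_Icc y).2)
  rcases hx with hx | hx <;> simp [bobkovIntegrand, hfderiv, hx]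

lemma integral_bobkovIntegrand_le {L K : ℝ} (hL : 0 ≤ L) (hA : MeasurableSet A)
    (hB : MeasurableSet B) (hfA : ∀ x ∈ A, f x = 1) (hfB : ∀ x ∉ B, f x = 0)
    (hK : ∀ x, ‖fderiv ℝ f x‖ ≤ K) :
    ∫ x, bobkovIntegrand L f x ∂ν ≤ (1 / 4 + L * K) * ν.real (B \ A) := by
  rw [mul_comm, ← smul_eq_mul, ← integral_indicator_const _ (hB.diff hA)]
  refine integral_mono hf.integrable_bobkovIntegrand ((integrable_const _).indicator (hB.diff hA))
    (le_indicator (fun x _ => ?_) fun x hx => ?_)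
  · exact (hf.bobkovIntegrand_le hL x).trans (by gcongr; exact hK x)
  · refine (hf.bobkovIntegrand_eq_zero ?_).le
    by_cases hxA : x ∈ A
    · exact .inr (hfA x hxA)
    · exact .inl (hfB x fun hxB => hx ⟨hxB, hxA⟩)

end IsTestFunction

namespace DefectiveBobkov

variable [FiniteDimensional ℝ E] [MeasurableSpace E] [BorelSpace E] {ν : Measure E}
  [IsProbabilityMeasure ν] {L δ : ℝ} (hν : DefectiveBobkov ν L δ)
include hν

lemma mul_one_sub_le_cthickening_diff (hL : 0 ≤ L) {A : Set E} (hA : A.Nonempty)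
    (hAm : MeasurableSet A) {h : ℝ} (hh : 0 < h) :
    ν.real A * (1 - ν.real A)
      ≤ (5 / 4 + L * (2 / h)) * ν.real (Metric.cthickening h A \ A) + δ := by
  obtain ⟨f, hf, hfd, hfA, hfB⟩ := exists_isTestFunction_cutoff hA hh
  have hBm := (Metric.isClosed_cthickening (δ := h) (E := A)).measurableSet
  have hlow : ν.real A ≤ ∫ x, f x ∂ν := hf.measureReal_le_integral hAm hfA
  have hupp : ∫ x, f x ∂ν ≤ ν.real (Metric.cthickening h A \ A) + ν.real A := by
    rw [measureReal_sdiff (Metric.self_subset_cthickening A) hAm, sub_add_cancel]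
    exact hf.integral_le_measureReal hBm hfB
  have hbob := hf.integral_bobkovIntegrand_le (ν := ν) hL hAm hBm hfA hfB hfd
  nlinarith [hν f hf, (hf.integral_mem_Icc (μ := ν)).2, measureReal_nonneg (μ := ν) (s := A)]

theorem le_boundaryMeasure (hL : 0 < L) {A : Set E} (hA : MeasurableSet A) :
    ENNReal.ofReal ((ν.real A * (1 - ν.real A) - δ) / (3 * L)) ≤ boundaryMeasure ν A := by
  rcases A.eq_empty_or_nonempty with rfl | hne
  · have : (0 - δ) / (3 * L) ≤ 0 :=
      div_nonpos_of_nonpos_of_nonneg (by linarith [hν.defect_nonneg]) (by positivity)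
    rw [measureReal_empty, zero_mul, ENNReal.ofReal_of_nonpos this]
    exact bot_le
  refine le_liminf_of_le (by isBoundedDefault) ?_
  filter_upwards [Ioo_mem_nhdsGT (show 0 < 4 / 5 * L by positivity)] with h ⟨hh, hhL⟩
  rw [ENNReal.le_div_iff_mul_le (.inl (by simpa using hh)) (.inl ENNReal.ofReal_ne_top),
    ← ENNReal.ofReal_mul' hh.le, ← ofReal_measureReal]
  apply ENNReal.ofReal_le_ofReal
  rw [div_mul_eq_mul_div, div_le_iff₀ (by positivity)]
  have hcoef : (5 / 4 + L * (2 / h)) * h ≤ 3 * L := by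
    field_simp
    linarith
  calc (ν.real A * (1 - ν.real A) - δ) * h
      ≤ (5 / 4 + L * (2 / h)) * ν.real (Metric.cthickening h A \ A) * h := by
        gcongr
        linarith [hν.mul_one_sub_le_cthickening_diff hL.le hne hA hh]
    _ = ν.real (Metric.cthickening h A \ A) * ((5 / 4 + L * (2 / h)) * h) := by ring
    _ ≤ ν.real (Metric.cthickening h A \ A) * (3 * L) := by gcongr

theorem le_isoProfile (hL : 0 < L) (t : ℝ) :
    ENNReal.ofReal ((t * (1 - t) - δ) / (3 * L)) ≤ isoProfile ν t := by
  refine le_sInf ?_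
  rintro _ ⟨A, hA, hAt, rfl⟩
  rcases le_or_gt t 0 with ht | ht
  · rw [ENNReal.ofReal_of_nonpos]
    · exact bot_le
    · refine div_nonpos_of_nonpos_of_nonneg ?_ (by positivity)
      nlinarith [hν.defect_nonneg]
  · have hreal : ν.real A = t := by rw [measureReal_def, hAt, ENNReal.toReal_ofReal ht.le]
    exact hreal ▸ hν.le_boundaryMeasure hL hA

end DefectiveBobkov

end Cheeger

section HalfLine

variable {Φ ψ : ℝ → ℝ} {R r x y M N k l δ ε σ θ b : ℝ}

lemma continuousOn_Ici_of_concaveOn (hconc : ConcaveOn ℝ (Ici 0) Φ)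
    (hcont : ContinuousWithinAt Φ (Ici 0) 0) : ContinuousOn Φ (Ici 0) := by
  intro x hx
  rcases (mem_Ici.1 hx).eq_or_lt with rfl | hx0
  · exact hcont
  · have hint := hconc.continuousOn_interior
    rw [interior_Ici] at hint
    exact (hint.continuousAt (Ioi_mem_nhds hx0)).continuousWithinAt

lemma continuous_comp_abs (hcont : ContinuousOn Φ (Ici 0)) : Continuous fun x => Φ |x| :=
  hcont.comp_continuous continuous_abs abs_nonneg

lemma tendsto_atTop_of_integrable_exp_neg (hmono : MonotoneOn Φ (Ici 0))
    (hint : Integrable fun x => Real.exp (-Φ |x|)) : Tendsto Φ atTop atTop := by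
  refine tendsto_atTop.2 fun B => ?_
  obtain ⟨x, hx⟩ : ∃ x, B ≤ Φ |x| := by
    by_contra! hlt
    have hconst : Integrable fun _ : ℝ => Real.exp (-B) := by
      refine hint.mono' aestronglyMeasurable_const (.of_forall fun x => ?_)
      rw [Real.norm_of_nonneg (Real.exp_nonneg _)]
      exact Real.exp_le_exp.2 (neg_le_neg (hlt x).le)
    rcases integrable_const_iff.1 hconst with hzero | hfinite
    · exact (Real.exp_pos _).ne' hzero
    · simpa using hfinite.measure_univ_lt_top
  filter_upwards [eventually_ge_atTop |x|] with y hy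
  exact hx.trans (hmono (abs_nonneg x) ((abs_nonneg x).trans hy) hy)

lemma exists_pos_le_of_le (hcont : ContinuousWithinAt Φ (Ici 0) 0) (hb : Φ 0 < b) :
    ∃ δ > 0, ∀ x, 0 ≤ x → b ≤ Φ x → δ ≤ x := by
  obtain ⟨δ, hδ, hsub⟩ := mem_nhdsGE_iff_exists_Ico_subset.1 (hcont.eventually_lt_const hb)
  refine ⟨δ, hδ, fun x hx hbx => ?_⟩
  by_contra! hlt
  exact hbx.not_gt (hsub ⟨hx, hlt⟩)

lemma surjOn_Ici (hcont : ContinuousOn Φ (Ici 0)) (htop : Tendsto Φ atTop atTop) :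
    SurjOn Φ (Ici 0) (Ici (Φ 0)) :=
  isPreconnected_Ici.intermediate_value_Ici self_mem_Ici
    (le_principal_iff.2 (Ici_mem_atTop 0)) hcont htop

lemma halfLineInv_nonneg (hΦ : SurjOn Φ (Ici 0) (Ici (Φ 0))) (hb : Φ 0 ≤ b) :
    0 ≤ halfLineInv Φ b :=
  hΦ.mapsTo_invFunOn hb

lemma apply_halfLineInv (hΦ : SurjOn Φ (Ici 0) (Ici (Φ 0))) (hb : Φ 0 ≤ b) :
    Φ (halfLineInv Φ b) = b :=
  hΦ.rightInvOn_invFunOn hb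

lemma half_mul_le_of_convexOn (hψ : ConvexOn ℝ (Ioi R) ψ) (hr : 0 ≤ r) (hRr : R < r)
    (hrx : r < x) (hψr : 0 ≤ ψ r) (hψx : 2 * ψ r ≤ ψ x) (hk : 1 ≤ k) :
    k / 2 * ψ x ≤ ψ (k * x) := by
  have hxk : x ≤ k * x := le_mul_of_one_le_left (hr.trans hrx.le) hk
  have hsecant := hψ.secant_mono (a := r) (x := x) (y := k * x) hRr (hRr.trans hrx)
    (hRr.trans (hrx.trans_le hxk)) hrx.ne' (hrx.trans_le hxk).ne' hxk
  rw [div_le_div_iff₀ (by linarith) (by linarith)] at hsecant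
  refine le_of_mul_le_mul_right ?_ (sub_pos.2 hrx)
  calc k / 2 * ψ x * (x - r) = ψ x / 2 * (k * (x - r)) := by ring
    _ ≤ (ψ x - ψ r) * (k * x - r) := by
      have := mul_le_mul_of_nonneg_right hk hr
      have := mul_nonneg (zero_le_one.trans hk) (sub_pos.2 hrx).le
      exact mul_le_mul (by linarith) (by linarith) this (by linarith)
    _ ≤ (ψ (k * x) - ψ r) * (x - r) := hsecant
    _ ≤ ψ (k * x) * (x - r) := by
      have := sub_pos.2 hrx
      gcongr
      linarith

lemma eventually_two_mul_le_of_convexOn_rpow (htop : Tendsto Φ atTop atTop) (hθ : 0 < θ)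
    (hconv : ConvexOn ℝ (Ioi R) fun x => Φ x ^ θ) :
    ∀ᶠ x in atTop, ∀ k, 2 * 2 ^ θ ≤ k → 2 * Φ x ≤ Φ (k * x) := by
  obtain ⟨r, ⟨hΦr, hRr⟩, hr⟩ := ((htop.eventually_gt_atTop 0).and
    (eventually_gt_atTop R) |>.and (eventually_ge_atTop 0)).exists
  filter_upwards [((tendsto_rpow_atTop hθ).comp htop).eventually_ge_atTop (2 * Φ r ^ θ),
    eventually_forall_ge_atTop.2 (htop.eventually_gt_atTop 0), eventually_gt_atTop r]
    with x hψx hpos hrx k hk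
  have htwo : (1 : ℝ) ≤ 2 ^ θ := Real.one_le_rpow one_le_two hθ.le
  have hk1 : 1 ≤ k := by linarith
  have hΦx := hpos x le_rfl
  have hΦkx := hpos (k * x) (le_mul_of_one_le_left (hr.trans hrx.le) hk1)
  rw [← Real.rpow_le_rpow_iff (by positivity) hΦkx.le hθ, Real.mul_rpow zero_le_two hΦx.le]
  calc 2 ^ θ * Φ x ^ θ ≤ k / 2 * Φ x ^ θ := by
        gcongr
        linarith
    _ ≤ Φ (k * x) ^ θ := half_mul_le_of_convexOn hconv hr hRr hrx (by positivity) hψx hk1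

lemma eventually_forall_two_mul_le (hmono : MonotoneOn Φ (Ici 0)) (htop : Tendsto Φ atTop atTop)
    (hθ : 0 < θ) (hconv : ConvexOn ℝ (Ioi R) fun x => Φ x ^ θ) (hδ : 0 < δ) :
    ∀ᶠ k in atTop, ∀ x, δ ≤ x → 2 * Φ x ≤ Φ (k * x) := by
  obtain ⟨X, hX⟩ := eventually_atTop.1 (eventually_two_mul_le_of_convexOn_rpow htop hθ hconv)
  obtain ⟨Y, hY⟩ := eventually_atTop.1 (htop.eventually_ge_atTop (2 * Φ X))
  filter_upwards [eventually_ge_atTop (2 * 2 ^ θ), eventually_ge_atTop (Y / δ),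
    eventually_ge_atTop 0] with k hkθ hkY hk x hx
  rcases le_total X x with hXx | hxX
  · exact hX x hXx k hkθ
  · have hYkx : Y ≤ k * x := ((div_le_iff₀ hδ).1 hkY).trans (by gcongr)
    have hx0 : 0 ≤ x := hδ.le.trans hx
    linarith [hmono hx0 (hx0.trans hxX) hxX, hY _ hYkx]

lemma add_slope_mul_le_of_concaveOn {s : Set ℝ} (hconc : ConcaveOn ℝ s Φ) (hx : x ∈ s)
    (hN : N ∈ s) (hxy : x ≤ y) (hyM : y ≤ M) (hMN : M < N) :
    Φ x + slope Φ M N * (y - x) ≤ Φ y := by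
  rcases hxy.eq_or_lt with rfl | hxy
  · simp
  have hM : M ∈ s := hconc.1.ordConnected.out hx hN ⟨hxy.le.trans hyM, hMN.le⟩
  have hslope : slope Φ M N ≤ (Φ y - Φ x) / (y - x) := by
    rw [slope_def_field]
    rcases hyM.eq_or_lt with rfl | hyM
    · exact hconc.slope_anti_adjacent hx hN hxy hMN
    · have hy : y ∈ s := hconc.1.ordConnected.out hx hM ⟨hxy.le, hyM.le⟩
      exact (hconc.slope_anti_adjacent hy hN hyM hMN).trans
        (hconc.slope_anti_adjacent hx hM hxy hyM)
  linarith [(le_div_iff₀ (sub_pos.2 hxy)).1 hslope]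

lemma intervalIntegral_exp_neg_le (hψ : ContinuousOn ψ (Icc x M)) (hσ : 0 < σ) (hxM : x ≤ M)
    (hle : ∀ y ∈ Icc x M, ψ x + σ * (y - x) ≤ ψ y) :
    ∫ y in x..M, Real.exp (-ψ y) ≤ σ⁻¹ * Real.exp (-ψ x) := by
  have hderiv (y : ℝ) : HasDerivAt (fun y => -σ⁻¹ * Real.exp (-(ψ x + σ * (y - x))))
      (Real.exp (-(ψ x + σ * (y - x)))) y := by
    have hlin := (((hasDerivAt_id' y).sub_const x).const_mul σ).const_add (ψ x)
    refine (hlin.fun_neg.exp.const_mul (-σ⁻¹)).congr_deriv ?_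
    field_simp
  have hcont : Continuous fun y => Real.exp (-(ψ x + σ * (y - x))) := by fun_prop
  calc ∫ y in x..M, Real.exp (-ψ y) ≤ ∫ y in x..M, Real.exp (-(ψ x + σ * (y - x))) := by
        refine intervalIntegral.integral_mono_on hxM ?_ (hcont.intervalIntegrable _ _)
          fun y hy => Real.exp_le_exp.2 (neg_le_neg (hle y hy))
        exact (hψ.neg.rexp.mono (uIcc_of_le hxM).subset).intervalIntegrable
    _ = σ⁻¹ * Real.exp (-ψ x) - σ⁻¹ * Real.exp (-(ψ x + σ * (M - x))) := by
        rw [intervalIntegral.integral_eq_sub_of_hasDerivAt (fun y _ => hderiv y)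
          (hcont.intervalIntegrable _ _), sub_self, mul_zero, add_zero]
        ring
    _ ≤ σ⁻¹ * Real.exp (-ψ x) := sub_le_self _ (by positivity)

lemma rightDeriv_le_slope_of_concaveOn {s : Set ℝ} (hconc : ConcaveOn ℝ s Φ) (hx : x ∈ s)
    (hy : y ∈ interior s) (hxy : x < y) : rightDeriv Φ y ≤ slope Φ x y := by
  have hneg : slope (-Φ) x y ≤ derivWithin (-Φ) (Ioi y) y :=
    (hconc.neg.slope_le_leftDeriv_of_mem_interior hx hy hxy).trans
      (hconc.neg.leftDeriv_le_rightDeriv_of_mem_interior hy)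
  rw [derivWithin.neg, slope_neg_fun] at hneg
  exact neg_le_neg_iff.1 hneg

lemma rightDeriv_le_mul_slope (hconc : ConcaveOn ℝ (Ici 0) Φ) (hb : 0 < b) (hx : 0 < x)
    (hbx : b ≤ Φ x) (hl : 1 < l) (hdbl : 2 * Φ x ≤ Φ (l * x))
    (hdbl' : 2 * Φ (l * x) ≤ Φ (l * (l * x))) :
    rightDeriv Φ x ≤ (1 + |Φ 0| / b) * l ^ 2 * slope Φ (l * x) (l * (l * x)) := by
  have hΦx : 0 < Φ x := hb.trans_le hbx
  have hxl : x < l * x := lt_mul_of_one_lt_left hx hl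
  have hll : l * x < l * (l * x) := lt_mul_of_one_lt_left (hx.trans hxl) hl
  have hΦ0 : |Φ 0| ≤ |Φ 0| / b * Φ x := by
    rw [div_mul_eq_mul_div, le_div_iff₀ hb]
    gcongr
  have hslope : Φ x / (l ^ 2 * x) ≤ slope Φ (l * x) (l * (l * x)) := by
    rw [slope_def_field]
    exact div_le_div₀ (by linarith) (by linarith) (by linarith) (by linarith)
  calc rightDeriv Φ x ≤ slope Φ 0 x :=
        rightDeriv_le_slope_of_concaveOn hconc self_mem_Ici (by simpa using hx) hx
    _ = (Φ x - Φ 0) / x := by rw [slope_def_field, sub_zero]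
    _ ≤ (1 + |Φ 0| / b) * Φ x / x := by
        gcongr
        linarith [neg_le_abs (Φ 0)]
    _ = (1 + |Φ 0| / b) * l ^ 2 * (Φ x / (l ^ 2 * x)) := by field_simp
    _ ≤ (1 + |Φ 0| / b) * l ^ 2 * slope Φ (l * x) (l * (l * x)) := by gcongr

end HalfLine

section MuPhi

variable {Φ : ℝ → ℝ} {x M N l δ ε b t : ℝ} (hint : Integrable fun x : ℝ => Real.exp (-Φ |x|))

lemma tendsto_setIntegral_compl_Ioc {u : ℝ → ℝ} (hu : Integrable u) :
    Tendsto (fun M => ∫ x in (Ioc (-M) M)ᶜ, u x) atTop (𝓝 0) := by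
  have hlim := (intervalIntegral_tendsto_integral hu tendsto_neg_atTop_atBot tendsto_id).const_sub
    (∫ x, u x)
  rw [sub_self] at hlim
  refine hlim.congr' ?_
  filter_upwards [eventually_ge_atTop 0] with M hM
  rw [setIntegral_compl measurableSet_Ioc hu, id,
    intervalIntegral.integral_of_le (neg_le_self hM)]

lemma min_one_sub_mem_Icc (ht : t ∈ Icc 0 1) : min t (1 - t) ∈ Icc 0 (1 / 2) :=
  ⟨le_min ht.1 (sub_nonneg.2 ht.2), by linarith [min_le_left t (1 - t), min_le_right t (1 - t)]⟩

lemma half_min_le_mul_one_sub (ht : t ∈ Icc 0 1) : min t (1 - t) / 2 ≤ t * (1 - t) := by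
  rcases le_total t (1 - t) with h | h
  · rw [min_eq_left h]
    nlinarith [ht.1]
  · rw [min_eq_right h]
    nlinarith [ht.2]

lemma natCast_mul_exp_neg_log_div {n : ℕ} {m : ℝ} (hn : n ≠ 0) (hm : 0 < m) :
    n * Real.exp (-Real.log (n / m)) = m := by
  rw [Real.exp_neg, Real.exp_log (by positivity), inv_div, mul_div_cancel₀ _ (by positivity)]

lemma log_two_le_log_natCast_div {n : ℕ} {m : ℝ} (hn : 1 ≤ n) (hm : 0 < m) (hm2 : m ≤ 1 / 2) :
    Real.log 2 ≤ Real.log (n / m) := by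
  refine Real.log_le_log two_pos ((le_div_iff₀ hm).2 ?_)
  linarith [Nat.one_le_cast (α := ℝ) |>.2 hn]

include hint

lemma isProbabilityMeasure_muPhi : IsProbabilityMeasure (muPhi Φ) := by
  have hZ := integral_exp_pos hint
  refine ⟨?_⟩
  rw [muPhi, withDensity_apply _ MeasurableSet.univ, Measure.restrict_univ,
    ← ofReal_integral_eq_lintegral_ofReal (hint.const_mul _)
      (.of_forall fun x => by positivity), integral_const_mul, inv_mul_cancel₀ hZ.ne',
    ENNReal.ofReal_one]

lemma muPhi_real {S : Set ℝ} (hS : MeasurableSet S) :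
    (muPhi Φ).real S = (∫ x : ℝ, Real.exp (-Φ |x|))⁻¹ * ∫ x in S, Real.exp (-Φ |x|) := by
  have hZ := integral_exp_pos hint
  rw [measureReal_def, muPhi, withDensity_apply _ hS,
    ← ofReal_integral_eq_lintegral_ofReal (hint.integrableOn.const_mul _)
      (.of_forall fun x => by positivity), integral_const_mul, ENNReal.toReal_ofReal]
  exact mul_nonneg (by positivity) (integral_nonneg fun x => (Real.exp_pos _).le)

lemma setIntegral_compl_Ioc_exp_neg_le (hmono : MonotoneOn Φ (Ici 0)) (hl : 0 < l)
    (hdbl : ∀ y, x ≤ y → 2 * Φ y ≤ Φ (l * y)) (hx : 0 ≤ x) (hM : l * x ≤ M) :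
    ∫ y in (Ioc (-M) M)ᶜ, Real.exp (-Φ |y|)
      ≤ Real.exp (-Φ x) * ∫ y in (Ioc (-M) M)ᶜ, Real.exp (-Φ |y / l|) := by
  rw [← integral_const_mul]
  refine setIntegral_mono_on hint.integrableOn
    ((hint.comp_div hl.ne').integrableOn.const_mul _) measurableSet_Ioc.compl fun y hy => ?_
  have hMy : M ≤ |y| := by
    by_contra! hlt
    exact hy ⟨(abs_lt.1 hlt).1, (abs_lt.1 hlt).2.le⟩
  have hxy : x ≤ |y / l| := by
    rw [abs_div, abs_of_pos hl, le_div_iff₀' hl]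
    exact hM.trans hMy
  have hly : l * |y / l| = |y| := by rw [abs_div, abs_of_pos hl, mul_div_cancel₀ _ hl.ne']
  have hΦy := hdbl _ hxy
  rw [hly] at hΦy
  rw [← Real.exp_add]
  exact Real.exp_le_exp.2 (by linarith [hmono hx (hx.trans hxy) hxy])

lemma eventually_forall_tail_le (hmono : MonotoneOn Φ (Ici 0)) (hδ : 0 < δ) (hε : 0 < ε)
    (hdbl : ∀ᶠ k in atTop, ∀ x, δ ≤ x → 2 * Φ x ≤ Φ (k * x)) :
    ∀ᶠ k in atTop, ∀ x, δ ≤ x →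
      (muPhi Φ).real (Ioc (-(k * x)) (k * x))ᶜ ≤ ε * Real.exp (-Φ x) := by
  have hZ := integral_exp_pos hint
  obtain ⟨l, hl, hdbl⟩ := ((eventually_gt_atTop 0).and hdbl).exists
  obtain ⟨M₀, hM₀⟩ := eventually_atTop.1 ((tendsto_setIntegral_compl_Ioc
    (hint.comp_div hl.ne')).eventually_le_const (mul_pos hε hZ))
  filter_upwards [eventually_ge_atTop l, eventually_ge_atTop (M₀ / δ)] with k hlk hk x hx
  have hx0 : 0 ≤ x := hδ.le.trans hx
  have hM₀k : M₀ ≤ k * x := ((div_le_iff₀ hδ).1 hk).trans (by gcongr; exact hl.le.trans hlk)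
  rw [muPhi_real hint measurableSet_Ioc.compl, inv_mul_le_iff₀ hZ]
  calc ∫ y in (Ioc (-(k * x)) (k * x))ᶜ, Real.exp (-Φ |y|)
      ≤ Real.exp (-Φ x) * ∫ y in (Ioc (-(k * x)) (k * x))ᶜ, Real.exp (-Φ |y / l|) :=
        setIntegral_compl_Ioc_exp_neg_le hint hmono hl (fun y hy => hdbl y (hx.trans hy)) hx0
          (by gcongr)
    _ ≤ Real.exp (-Φ x) * (ε * ∫ y, Real.exp (-Φ |y|)) := by
        gcongr
        exact hM₀ _ hM₀k
    _ = (∫ y, Real.exp (-Φ |y|)) * (ε * Real.exp (-Φ x)) := by ring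

lemma exists_doubling_scale (hmono : MonotoneOn Φ (Ici 0)) {θ R : ℝ} (hθ : 0 < θ)
    (hconv : ConvexOn ℝ (Ioi R) fun x => Φ x ^ θ) (hδ : 0 < δ) (hε : 0 < ε) :
    ∃ l > 1, ∀ x, δ ≤ x → 2 * Φ x ≤ Φ (l * x) ∧
      (muPhi Φ).real (Ioc (-(l * x)) (l * x))ᶜ ≤ ε * Real.exp (-Φ x) := by
  have hdbl := eventually_forall_two_mul_le hmono (tendsto_atTop_of_integrable_exp_neg hmono hint)
    hθ hconv hδ
  obtain ⟨l, hl, hlΦ, hltail⟩ := ((eventually_gt_atTop 1).and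
    (hdbl.and (eventually_forall_tail_le hint hmono hδ hε hdbl))).exists
  exact ⟨l, hl, fun x hx => ⟨hlΦ x hx, hltail x hx⟩⟩

/- By concavity `Φ` grows on `[0, M]` at least at the rate of its chord over `[M, N]`, so the
truncated tails `∫ y in x..M, exp (-Φ y)` decay at that rate. -/
lemma defectiveBobkov_muPhi (hconc : ConcaveOn ℝ (Ici 0) Φ) (hcont : ContinuousOn Φ (Ici 0))
    (hM : 0 ≤ M) (hMN : M < N) (hΦ : Φ M < Φ N) :
    DefectiveBobkov (muPhi Φ) (5 * (slope Φ M N)⁻¹) ((muPhi Φ).real (Ioc (-M) M)ᶜ) := by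
  have := isProbabilityMeasure_muPhi hint
  have hZ := integral_exp_pos hint
  have hσ : 0 < slope Φ M N := (slope_pos_iff_of_le hMN.le).2 hΦ
  have habs := continuous_comp_abs hcont
  refine defectiveBobkov_of_integral_le rfl (habs.neg.rexp.const_mul _) (fun x => by positivity)
    (fun x => by rw [abs_neg]) hM fun x hx => ?_
  rw [intervalIntegral.integral_const_mul, mul_left_comm]
  gcongr
  refine intervalIntegral_exp_neg_le habs.continuousOn hσ hx.2 fun y hy => ?_
  rw [abs_of_nonneg hx.1, abs_of_nonneg (hx.1.trans hy.1)]
  exact add_slope_mul_le_of_concaveOn hconc hx.1 (hM.trans hMN.le) hy.1 hy.2 hMN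

lemma le_isoProfile_of_tail_le (hconc : ConcaveOn ℝ (Ici 0) Φ) (hcont : ContinuousOn Φ (Ici 0))
    (hM : 0 ≤ M) (hMN : M < N) (hΦ : Φ M < Φ N) {n : ℕ} (ht : t ∈ Icc 0 1)
    (htail : n * (muPhi Φ).real (Ioc (-M) M)ᶜ ≤ min t (1 - t) / 4) :
    ENNReal.ofReal (min t (1 - t) * slope Φ M N / 60) ≤ isoProfile (prodMeasure (muPhi Φ) n) t := by
  have := isProbabilityMeasure_muPhi hint
  have hσ : 0 < slope Φ M N := (slope_pos_iff_of_le hMN.le).2 hΦ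
  have hbobkov := (defectiveBobkov_muPhi hint hconc hcont hM hMN hΦ).prodMeasure n
  refine (ENNReal.ofReal_le_ofReal ?_).trans (hbobkov.le_isoProfile (by positivity) t)
  have hmin := half_min_le_mul_one_sub ht
  calc min t (1 - t) * slope Φ M N / 60
      = min t (1 - t) / 4 / (3 * (5 * (slope Φ M N)⁻¹)) := by
        field_simp
        ring
    _ ≤ (t * (1 - t) - n * (muPhi Φ).real (Ioc (-M) M)ᶜ) / (3 * (5 * (slope Φ M N)⁻¹)) := by
        gcongr
        linarith

theorem le_isoProfile_of_doubling (hconc : ConcaveOn ℝ (Ici 0) Φ)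
    (hcont : ContinuousOn Φ (Ici 0)) (hb : 0 < b) (hx : 0 < x) (hbx : b ≤ Φ x) (hl : 1 < l)
    (hdbl : ∀ y, x ≤ y → 2 * Φ y ≤ Φ (l * y))
    (htail : (muPhi Φ).real (Ioc (-(l * x)) (l * x))ᶜ ≤ 1 / 4 * Real.exp (-Φ x)) {n : ℕ}
    (ht : t ∈ Icc 0 1) (hn : n * Real.exp (-Φ x) ≤ min t (1 - t)) :
    ENNReal.ofReal ((60 * ((1 + |Φ 0| / b) * l ^ 2))⁻¹ * min t (1 - t) * rightDeriv Φ x)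
      ≤ isoProfile (prodMeasure (muPhi Φ) n) t := by
  have hxl : x < l * x := lt_mul_of_one_lt_left hx hl
  have hll : l * x < l * (l * x) := lt_mul_of_one_lt_left (hx.trans hxl) hl
  have hmin : 0 ≤ min t (1 - t) := (min_one_sub_mem_Icc ht).1
  have hntail : n * (muPhi Φ).real (Ioc (-(l * x)) (l * x))ᶜ ≤ min t (1 - t) / 4 := by
    calc n * (muPhi Φ).real (Ioc (-(l * x)) (l * x))ᶜ ≤ n * (1 / 4 * Real.exp (-Φ x)) := by gcongr
      _ = n * Real.exp (-Φ x) / 4 := by ring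
      _ ≤ min t (1 - t) / 4 := by gcongr
  have hΦ : Φ (l * x) < Φ (l * (l * x)) := by linarith [hdbl x le_rfl, hdbl (l * x) hxl.le]
  refine (ENNReal.ofReal_le_ofReal ?_).trans
    (le_isoProfile_of_tail_le hint hconc hcont (hx.trans hxl).le hll hΦ ht hntail)
  have hderiv := rightDeriv_le_mul_slope hconc hb hx hbx hl (hdbl x le_rfl) (hdbl (l * x) hxl.le)
  calc (60 * ((1 + |Φ 0| / b) * l ^ 2))⁻¹ * min t (1 - t) * rightDeriv Φ x
      ≤ (60 * ((1 + |Φ 0| / b) * l ^ 2))⁻¹ * min t (1 - t) *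
          ((1 + |Φ 0| / b) * l ^ 2 * slope Φ (l * x) (l * (l * x))) := by gcongr
    _ = min t (1 - t) * slope Φ (l * x) (l * (l * x)) / 60 := by field_simp

end MuPhi

end HeavyTail

theorem mainTheorem3_general (Φ : ℝ → ℝ)
    (hmono : MonotoneOn Φ (Set.Ici 0))
    (hconc : ConcaveOn ℝ (Set.Ici 0) Φ)
    (hcont : ContinuousWithinAt Φ (Set.Ici 0) 0)
    (hzero : Φ 0 < Real.log 2)
    (hconv : ∃ θ : ℝ, 0 < θ ∧ ∃ R : ℝ, ConvexOn ℝ (Set.Ioi R) (fun x : ℝ => Φ x ^ θ))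
    (hint : MeasureTheory.Integrable (fun x : ℝ => Real.exp (-Φ |x|))) :
    ∃ c : ℝ, 0 < c ∧ ∀ n : ℕ, 1 ≤ n → ∀ t ∈ Set.Icc (0 : ℝ) 1,
      ENNReal.ofReal (c * min t (1 - t) *
          HeavyTail.rightDeriv Φ (HeavyTail.halfLineInv Φ (Real.log ((n : ℝ) / min t (1 - t)))))
        ≤ HeavyTail.isoProfile (HeavyTail.prodMeasure (HeavyTail.muPhi Φ) n) t := by
  open HeavyTail in
  obtain ⟨θ, hθ, R, hconv⟩ := hconv
  have hon := continuousOn_Ici_of_concaveOn hconc hcont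
  have hsurj := surjOn_Ici hon (tendsto_atTop_of_integrable_exp_neg hmono hint)
  obtain ⟨δ, hδ, hδΦ⟩ := exists_pos_le_of_le hcont hzero
  obtain ⟨l, hl, hscale⟩ := exists_doubling_scale hint hmono hθ hconv hδ (one_div_pos.2 four_pos)
  have hlog2 : 0 < Real.log 2 := Real.log_pos one_lt_two
  refine ⟨(60 * ((1 + |Φ 0| / Real.log 2) * l ^ 2))⁻¹, by positivity, fun n hn t ht => ?_⟩
  obtain ⟨hm0, hm2⟩ := min_one_sub_mem_Icc ht
  rcases hm0.eq_or_lt with hm | hm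
  · simp [← hm]
  have hlog := log_two_le_log_natCast_div hn hm hm2
  have hΦx := apply_halfLineInv hsurj (hzero.le.trans hlog)
  have hδx := hδΦ _ (halfLineInv_nonneg hsurj (hzero.le.trans hlog)) (hlog.trans_eq hΦx.symm)
  refine le_isoProfile_of_doubling hint hconc hon hlog2 (hδ.trans_le hδx) (hlog.trans_eq hΦx.symm)
    hl (fun y hy => (hscale y (hδx.trans hy)).1) (hscale _ hδx).2 ht ?_
  rw [hΦx, natCast_mul_exp_neg_log_div (by positivity) hm]

theorem mainTheorem3 (Φ : ℝ → ℝ)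
    (hmono : MonotoneOn Φ (Set.Ici 0))
    (hconc : ConcaveOn ℝ (Set.Ici 0) Φ)
    (hcont : ContinuousWithinAt Φ (Set.Ici 0) 0)
    (hlim : Filter.Tendsto (fun x : ℝ => Φ x / x) Filter.atTop (nhds 0))
    (hzero : Φ 0 < Real.log 2)
    (hC2 : ∃ R : ℝ, 0 ≤ R ∧ ContDiffOn ℝ 2 Φ (Set.Ioi R))
    (hconv : ∃ θ : ℝ, 1 < θ ∧ ∃ R : ℝ, 0 ≤ R ∧ ConvexOn ℝ (Set.Ioi R) (fun x : ℝ => Φ x ^ θ))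
    (hint : MeasureTheory.Integrable (fun x : ℝ => Real.exp (-Φ |x|))) :
    ∃ c : ℝ, 0 < c ∧ ∀ n : ℕ, 1 ≤ n → ∀ t ∈ Set.Icc (0 : ℝ) 1,
      ENNReal.ofReal (c * min t (1 - t) *
          HeavyTail.rightDeriv Φ (HeavyTail.halfLineInv Φ (Real.log ((n : ℝ) / min t (1 - t)))))
        ≤ HeavyTail.isoProfile (HeavyTail.prodMeasure (HeavyTail.muPhi Φ) n) t := 
  mainTheorem3_general Φ hmono hconc hcont hzero
    (hconv.imp fun _ ⟨hθ, hR⟩ => ⟨one_pos.trans hθ, hR.imp fun _ h => h.2⟩) hint
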